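/- Let $M$ be a smooth Hausdorff finite-dimensional manifold and let $\boldsymbol\eta\in\Omega^1(M,\mathbb R^k)$ be a $k$-contact form, i.e. a smooth $\mathbb R^k$-valued one-form such that $\ker\boldsymbol\eta$ is a non-zero regular distribution of corank $k$, $\ker \mathrm d\boldsymbol\eta$ is a regular distribution of rank $k$, and $\ker\boldsymbol\eta\cap\ker \mathrm d\boldsymbol\eta=0$. Let $R_1,\dots,R_k$ be its Reeb vector fields, determined by $\iota_{R_\alpha}\eta^\beta=\delta_\alpha^\beta$ and $\iota_{R_\alpha}\mathrm d\eta^\beta=0$. An $\boldsymbol\eta$-Hamiltonian vector field is a smooth vector field $X$ such that $[X,Y]$ takes values in $\ker\boldsymbol\eta$ for each smooth vector field $Y$ taking values in $\ker\boldsymbol\eta$; its $\boldsymbol\eta$-Hamiltonian $k$-function is $\boldsymbol f=-\iota_X\boldsymbol\eta$, which determines $X=:X_{\boldsymbol f}$. Put $\{\boldsymbol f,\boldsymbol g\}_{\boldsymbol\eta}=\boldsymbol\eta([X_{\boldsymbol f},X_{\boldsymbol g}])$ for $\boldsymbol\eta$-Hamiltonian $k$-functions $\boldsymbol f,\boldsymbol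 g$. Let $\theta\in\mathbb R^{k*}$ and $\omega=\langle \mathrm d\boldsymbol\eta,\theta\rangle$. (1) The form $\omega$ is presymplectic, i.e. a smooth closed two-form (its rank need not be constant). A Hamiltonian function of $\omega$ is a smooth function $f$ on $M$ such that $\iota_Y\omega=\mathrm df$ for some smooth vector field $Y$. An admissible function of $\omega$ is a smooth function $f$ such that $\mathrm df_x$ lies in the image of $v\mapsto\iota_v\omega_x$ for each $x\in M$. On admissible functions, $\{f,g\}_\omega(x)=\omega_x(v,w)$ for any $v,w\in T_xM$ with $\iota_v\omega_x=\mathrm df_x$ and $\iota_w\omega_x=\mathrm dg_x$. Let $\mathfrak W=\langle\boldsymbol h_1,\dots,\boldsymbol h_r\rangle$ be a finite-dimensional real vector space of $\boldsymbol\eta$-Hamiltonian $k$-functions that is closed under $\{\cdot,\cdot\}_{\boldsymbol\eta}$ and whose elements satisfy $R_\alpha\boldsymbol f=0$ for $\alpha=1,\dots,k$, and let $\mathfrak W^\theta=\langle\langle\boldsymbol h_1,\theta\rangle,\dots,\langle\boldsymbol h_r,\theta\rangle\rangle$. (2) The space $\mathfrak W$ is a Lie algebra under $\{\cdot,\cdot\}_{\boldsymbol\eta}$,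 the space $\mathfrak W^\theta$ consists of Hamiltonian functions of $\omega$ and is a Lie algebra under $\{\cdot,\cdot\}_\omega$, and $\boldsymbol f\mapsto\langle\boldsymbol f,\theta\rangle$ is a surjective Lie algebra morphism $\mathfrak W\to\mathfrak W^\theta$. (3) If $C$ is an admissible function of $\omega$ with $\{C,g\}_\omega=0$ for all $g\in\mathfrak W^\theta$, then $C$ is a constant of motion of each Lie system $X$ with $\boldsymbol\eta$-Lie–Hamilton algebra $\mathfrak W$, i.e. of each $t$-dependent vector field $X$ such that, for each $t\in\mathbb R$, $X_t$ is the $\boldsymbol\eta$-Hamiltonian vector field of some element of $\mathfrak W$. That is, $X_tC=0$ for all $t\in\mathbb R$, and $C$ is constant along each solution of $\mathrm dx/\mathrm dt=X(t,x)$ defined on an interval. -/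

import Mathlib

open scoped Manifold ContDiff

noncomputable section

namespace KContact

section Forms

variable {E : Type*} [NormedAddCommGroup E] [NormedSpace ℝ E]
variable {M : Type*} [TopologicalSpace M] [ChartedSpace E M]
variable {F : Type*} [NormedAddCommGroup F] [NormedSpace ℝ F]

variable (E M) in
/-- (Not necessarily continuous) vector fields on the manifold `M` modelled on `E`. -/
abbrev VField := (x : M) → TangentSpace 𝓘(ℝ, E) x

variable (E M F) in
/-- (Not necessarily continuous) `F`-valued differential `n`-forms on `M`. -/
abbrev DForm (n : ℕ) := (x : M) → (TangentSpace 𝓘(ℝ, E) x) [⋀^Fin n]→L[ℝ] F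

/-- Smooth vector fields. -/
def SmoothVF (X : VField E M) [IsManifold 𝓘(ℝ, E) ∞ M] : Prop :=
  ContMDiff 𝓘(ℝ, E) 𝓘(ℝ, E).tangent ∞ (fun x => (⟨x, X x⟩ : TangentBundle 𝓘(ℝ, E) M))

/-- The expression of a form in the preferred chart around `x₀`: its pullback under the inverse of
the chart. Only its values on the target of the chart are meaningful. -/
def inChart {n : ℕ} (Ω : DForm E M F n) (x₀ : M) (y : E) : E [⋀^Fin n]→L[ℝ] F :=
  (Ω ((extChartAt 𝓘(ℝ, E) x₀).symm y)).compContinuousLinearMap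
    (mfderiv 𝓘(ℝ, E) 𝓘(ℝ, E) (extChartAt 𝓘(ℝ, E) x₀).symm y : E →L[ℝ] _)

/-- A form is smooth if its expressions in charts are smooth. -/
def SmoothForm {n : ℕ} (Ω : DForm E M F n) : Prop :=
  ∀ x₀ : M, ContDiffOn ℝ ∞ (inChart Ω x₀) (extChartAt 𝓘(ℝ, E) x₀).target

/-- The exterior derivative of a form on a manifold, computed in the chart around each point. -/
def extD {n : ℕ} (Ω : DForm E M F n) : DForm E M F (n + 1) := fun x₀ =>
  (extDeriv (inChart Ω x₀) (extChartAt 𝓘(ℝ, E) x₀ x₀)).compContinuousLinearMap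
    (mfderiv 𝓘(ℝ, E) 𝓘(ℝ, E) (extChartAt 𝓘(ℝ, E) x₀) x₀ : _ →L[ℝ] E)

/-- The kernel at `x` of a one-form. -/
def ker₁ (η : DForm E M F 1) (x : M) : Submodule ℝ (TangentSpace 𝓘(ℝ, E) x) where
  carrier := {v | η x ![v] = 0}
  add_mem' := by
    intro v w hv hw
    have h : η x ![v + w] = η x ![v] + η x ![w] := (η x).map_vecCons_add ![] v w
    have hv' : η x ![v] = 0 := hv
    have hw' : η x ![w] = 0 := hw
    exact h.trans (by rw [hv', hw', add_zero])
  zero_mem' := (η x).map_coord_zero 0 rfl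
  smul_mem' := by
    intro c v hv
    have h : η x ![c • v] = c • η x ![v] := (η x).map_vecCons_smul ![] c v
    have hv' : η x ![v] = 0 := hv
    exact h.trans (by rw [hv', smul_zero])

/-- The kernel at `x` of a two-form: the vectors `v` with `ι_v Ω = 0`. -/
def ker₂ (Ω : DForm E M F 2) (x : M) : Submodule ℝ (TangentSpace 𝓘(ℝ, E) x) where
  carrier := {v | ∀ w, Ω x ![v, w] = 0}
  add_mem' := by
    intro v v' hv hv' w
    have h : Ω x ![v + v', w] = Ω x ![v, w] + Ω x ![v', w] := (Ω x).map_vecCons_add ![w] v v'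
    rw [h, hv w, hv' w, add_zero]
  zero_mem' := fun w => (Ω x).map_coord_zero 0 rfl
  smul_mem' := by
    intro c v hv w
    have h : Ω x ![c • v, w] = c • Ω x ![v, w] := (Ω x).map_vecCons_smul ![w] c v
    rw [h, hv w, smul_zero]

/-- The real-valued form `⟨β, θ⟩` obtained from an `F`-valued form `β` and a covector `θ`. -/
def pairForm {n : ℕ} (β : DForm E M F n) (θ : F →L[ℝ] ℝ) : DForm E M ℝ n :=
  fun x => θ.compContinuousAlternatingMap (β x)

end Forms

section Contact

variable {E : Type*} [NormedAddCommGroup E] [NormedSpace ℝ E]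
variable {M : Type*} [TopologicalSpace M] [ChartedSpace E M]
variable {k : ℕ}

/-- A `k`-contact form on `M`: a smooth `ℝ^k`-valued one-form `η` such that `ker η` is a non-zero
regular distribution of corank `k`, `ker dη` is a regular distribution of rank `k`, and
`ker η ∩ ker dη = 0`. -/
structure IsKContactForm (η : DForm E M (Fin k → ℝ) 1) : Prop where
  smooth : SmoothForm η
  ker_ne_bot : ∀ x, ker₁ η x ≠ ⊥
  corank_ker : ∀ x, Module.finrank ℝ (TangentSpace 𝓘(ℝ, E) x ⧸ ker₁ η x) = k
  rank_ker_extD : ∀ x, Module.finrank ℝ (ker₂ (extD η) x) = k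
  ker_inf_ker : ∀ x, ker₁ η x ⊓ ker₂ (extD η) x = ⊥

/-- `v` is the value at `x` of the `α`-th Reeb vector field:
`η^β(v) = δ_α^β` and `ι_v dη^β = 0` for all `β`. -/
def IsReebVector (η : DForm E M (Fin k → ℝ) 1) (α : Fin k) (x : M)
    (v : TangentSpace 𝓘(ℝ, E) x) : Prop :=
  η x ![v] = Pi.single α 1 ∧ ∀ w, extD η x ![v, w] = 0

/-- The `α`-th Reeb vector field `R_α`; `isReebVector_reeb` and `IsReebVector.unique` show that
for a `k`-contact form its defining conditions hold and determine it. -/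
def reeb (η : DForm E M (Fin k → ℝ) 1) (α : Fin k) : VField E M :=
  fun x => Classical.epsilon (IsReebVector η α x)

theorem isReebVector_reeb [FiniteDimensional ℝ E] {η : DForm E M (Fin k → ℝ) 1}
    (hη : IsKContactForm η) (α : Fin k) (x : M) : IsReebVector η α x (reeb η α x) := by
  have : FiniteDimensional ℝ (TangentSpace 𝓘(ℝ, E) x) := inferInstanceAs (FiniteDimensional ℝ E)
  apply Classical.epsilon_spec (p := IsReebVector η α x)
  let L : TangentSpace 𝓘(ℝ, E) x →ₗ[ℝ] (Fin k → ℝ) :=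
    { toFun := fun v => η x ![v]
      map_add' := fun v w => (η x).map_vecCons_add ![] v w
      map_smul' := fun c v => (η x).map_vecCons_smul ![] c v }
  let L' := L.domRestrict (ker₂ (extD η) x)
  have hinj : Function.Injective L' := by
    rw [← LinearMap.ker_eq_bot, LinearMap.ker_eq_bot']
    intro v hv
    have h : (v : TangentSpace 𝓘(ℝ, E) x) ∈ ker₁ η x ⊓ ker₂ (extD η) x := ⟨hv, v.2⟩
    rw [hη.ker_inf_ker x] at h
    exact Subtype.ext h
  have hsurj : Function.Surjective L' := by
    refine (LinearMap.injective_iff_surjective_of_finrank_eq_finrank ?_).1 hinj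
    rw [hη.rank_ker_extD x]; simp
  obtain ⟨v, hv⟩ := hsurj (Pi.single α 1)
  exact ⟨v, hv, v.2⟩

theorem IsReebVector.unique {η : DForm E M (Fin k → ℝ) 1}
    (hη : IsKContactForm η) {α : Fin k} {x : M} {v w : TangentSpace 𝓘(ℝ, E) x}
    (hv : IsReebVector η α x v) (hw : IsReebVector η α x w) : v = w := by
  have h : v - w ∈ ker₁ η x ⊓ ker₂ (extD η) x := by
    refine ⟨?_, (ker₂ (extD η) x).sub_mem hv.2 hw.2⟩
    have h1 : η x ![v - w + w] = η x ![v - w] + η x ![w] :=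
      (η x).map_vecCons_add ![] (v - w) w
    rw [sub_add_cancel] at h1
    have h2 : η x ![v] = η x ![w] := hv.1.trans hw.1.symm
    exact add_eq_right.1 (h1.symm.trans h2)
  rw [hη.ker_inf_ker x] at h
  exact sub_eq_zero.1 h

variable [IsManifold 𝓘(ℝ, E) ∞ M]

/-- `X` is an `η`-Hamiltonian vector field: a smooth Lie symmetry of the distribution `ker η`,
that is, `[X, Y]` takes values in `ker η` for each smooth `Y` that does. -/
def IsEtaHamiltonianVF (η : DForm E M (Fin k → ℝ) 1) (X : VField E M) : Prop :=
  SmoothVF X ∧ ∀ Y : VField E M, SmoothVF Y → (∀ x, Y x ∈ ker₁ η x) →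
    ∀ x, VectorField.mlieBracket 𝓘(ℝ, E) X Y x ∈ ker₁ η x

/-- `X` is an `η`-Hamiltonian vector field and `f = -ι_X η` is its `η`-Hamiltonian `k`-function. -/
def IsEtaHamiltonianPair (η : DForm E M (Fin k → ℝ) 1) (X : VField E M)
    (f : M → (Fin k → ℝ)) : Prop :=
  IsEtaHamiltonianVF η X ∧ ∀ x, f x = - η x ![X x]

/-- `f` is an `η`-Hamiltonian `k`-function. -/
def IsEtaHamiltonianKFun (η : DForm E M (Fin k → ℝ) 1) (f : M → (Fin k → ℝ)) : Prop :=
  ∃ X : VField E M, IsEtaHamiltonianPair η X f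

/-- The `η`-Hamiltonian vector field `X_f` of an `η`-Hamiltonian `k`-function `f`
(for a `k`-contact form it is uniquely determined by `f`). -/
def etaHamVF (η : DForm E M (Fin k → ℝ) 1) (f : M → (Fin k → ℝ)) : VField E M :=
  Classical.epsilon (fun X => IsEtaHamiltonianPair η X f)

/-- The bracket `{f, g}_η = η([X_f, X_g])` of `η`-Hamiltonian `k`-functions. -/
def etaBracket (η : DForm E M (Fin k → ℝ) 1) (f g : M → (Fin k → ℝ)) : M → (Fin k → ℝ) :=
  fun x => η x ![VectorField.mlieBracket 𝓘(ℝ, E) (etaHamVF η f) (etaHamVF η g) x]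

/-- `f` is annihilated by all the Reeb vector fields of `η`. -/
def ReebInvariant (η : DForm E M (Fin k → ℝ) 1) (f : M → (Fin k → ℝ)) : Prop :=
  ∀ (α : Fin k) (x : M), mfderiv 𝓘(ℝ, E) 𝓘(ℝ, Fin k → ℝ) f x (reeb η α x) = 0

/-- The `t`-dependent vector field `X` is a Lie system admitting `W` as an `η`-Lie–Hamilton
algebra: each `X_t` is the `η`-Hamiltonian vector field of some `h_t ∈ W`. -/
def AdmitsLieHamiltonAlgebra (η : DForm E M (Fin k → ℝ) 1)
    (W : Submodule ℝ (M → (Fin k → ℝ))) (X : ℝ → VField E M) : Prop :=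
  ∀ t, ∃ f ∈ W, IsEtaHamiltonianPair η (X t) f

end Contact

section Presymplectic

variable {E : Type*} [NormedAddCommGroup E] [NormedSpace ℝ E]
variable {M : Type*} [TopologicalSpace M] [ChartedSpace E M]

/-- A presymplectic form: a smooth closed real-valued two-form, not necessarily of constant rank. -/
def IsPresymplectic (Ω : DForm E M ℝ 2) : Prop :=
  SmoothForm Ω ∧ extD Ω = 0

/-- `ι_v Ω = df` at the point `x`. -/
def IsHamiltonianVector (Ω : DForm E M ℝ 2) (f : M → ℝ) (x : M)
    (v : TangentSpace 𝓘(ℝ, E) x) : Prop :=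
  ∀ w, Ω x ![v, w] = mfderiv 𝓘(ℝ, E) 𝓘(ℝ, ℝ) f x w

/-- A Hamiltonian function of `Ω`: a smooth `f` with `ι_X Ω = df` for a smooth vector field `X`. -/
def IsHamiltonianFunction [IsManifold 𝓘(ℝ, E) ∞ M] (Ω : DForm E M ℝ 2) (f : M → ℝ) : Prop :=
  ContMDiff 𝓘(ℝ, E) 𝓘(ℝ, ℝ) ∞ f ∧
    ∃ X : VField E M, SmoothVF X ∧ ∀ x, IsHamiltonianVector Ω f x (X x)

/-- An admissible function of `Ω`: a smooth `f` such that `df` takes values in the image of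
`v ↦ ι_v Ω`. Each Hamiltonian function is admissible. -/
def IsAdmissible (Ω : DForm E M ℝ 2) (f : M → ℝ) : Prop :=
  ContMDiff 𝓘(ℝ, E) 𝓘(ℝ, ℝ) ∞ f ∧ ∀ x, ∃ v, IsHamiltonianVector Ω f x v

/-- The Poisson bracket `{f, g}_Ω = Ω(X_f, X_g)` of admissible functions, where
`ι_{X_f} Ω = df` and `ι_{X_g} Ω = dg`; by `poissonBracket_eq` the choices do not matter. -/
def poissonBracket (Ω : DForm E M ℝ 2) (f g : M → ℝ) : M → ℝ := fun x =>
  Ω x ![Classical.epsilon (IsHamiltonianVector Ω f x), Classical.epsilon (IsHamiltonianVector Ω g x)]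

theorem poissonBracket_eq (Ω : DForm E M ℝ 2) {f g : M → ℝ} {x : M}
    {v w : TangentSpace 𝓘(ℝ, E) x} (hv : IsHamiltonianVector Ω f x v)
    (hw : IsHamiltonianVector Ω g x w) : poissonBracket Ω f g x = Ω x ![v, w] := by
  have hv' := Classical.epsilon_spec (p := IsHamiltonianVector Ω f x) ⟨v, hv⟩
  have hw' := Classical.epsilon_spec (p := IsHamiltonianVector Ω g x) ⟨w, hw⟩
  have swap : ∀ a b : TangentSpace 𝓘(ℝ, E) x, Ω x ![a, b] = - Ω x ![b, a] := by
    intro a b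
    have h : Ω x (![b, a] ∘ Equiv.swap 0 1) = - Ω x ![b, a] :=
      (Ω x).map_swap ![b, a] (i := 0) (j := 1) (by decide)
    have e : ![b, a] ∘ Equiv.swap 0 1 = ![a, b] := by
      funext i
      fin_cases i <;> simp
    rw [← h, e]
  unfold poissonBracket
  rw [hv', ← hv, swap, hw', ← hw, ← swap]

/-- `C` is a constant of motion of the `t`-dependent vector field `X`: it is constant along each
solution `γ` of `dγ/dt = X(t, γ)` defined on an interval. -/
def IsConstantOfMotion (X : ℝ → VField E M) (C : M → ℝ) : Prop :=
  ∀ (J : Set ℝ) (γ : ℝ → M), J.OrdConnected →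
    (∀ t ∈ J, HasMFDerivWithinAt 𝓘(ℝ, ℝ) 𝓘(ℝ, E) γ J t
      ((1 : ℝ →L[ℝ] ℝ).smulRight (X t (γ t)))) →
    ∀ s ∈ J, ∀ t ∈ J, C (γ s) = C (γ t)

end Presymplectic

section LieAlgebras

variable {A : Type*} [AddCommGroup A] [Module ℝ A]

/-- The linear subspace `V` is a Lie algebra under the restriction of the operation `br`. -/
structure IsLieAlgebra (V : Submodule ℝ A) (br : A → A → A) : Prop where
  closed : ∀ a ∈ V, ∀ b ∈ V, br a b ∈ V
  add_left : ∀ a ∈ V, ∀ b ∈ V, ∀ c ∈ V, br (a + b) c = br a c + br b c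
  add_right : ∀ a ∈ V, ∀ b ∈ V, ∀ c ∈ V, br a (b + c) = br a b + br a c
  smul_right : ∀ (r : ℝ), ∀ a ∈ V, ∀ b ∈ V, br a (r • b) = r • br a b
  self : ∀ a ∈ V, br a a = 0
  jacobi : ∀ a ∈ V, ∀ b ∈ V, ∀ c ∈ V, br a (br b c) = br (br a b) c + br b (br a c)

/-- The Lie ring structure on `V` with bracket `br`. -/
abbrev IsLieAlgebra.lieRing {V : Submodule ℝ A} {br : A → A → A} (h : IsLieAlgebra V br) :
    LieRing V where
  bracket a b := ⟨br a b, h.closed a a.2 b b.2⟩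
  add_lie a b c := Subtype.ext (h.add_left a a.2 b b.2 c c.2)
  lie_add a b c := Subtype.ext (h.add_right a a.2 b b.2 c c.2)
  lie_self a := Subtype.ext (h.self a a.2)
  leibniz_lie a b c := Subtype.ext (h.jacobi a a.2 b b.2 c c.2)

/-- The real Lie algebra structure on `V` with bracket `br`. -/
abbrev IsLieAlgebra.lieAlgebra {V : Submodule ℝ A} {br : A → A → A} (h : IsLieAlgebra V br) :
    @LieAlgebra ℝ V _ h.lieRing :=
  letI := h.lieRing
  { lie_smul := fun r a b => Subtype.ext (h.smul_right r a a.2 b b.2) }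

end LieAlgebras

end KContact

end

noncomputable section

namespace KContact

open Set Filter Topology VectorField

/-! Everything rests on one identity: a Hamiltonian field `X` with Reeb-invariant function `f = -ι_X
η` satisfies `ι_X dη = df` (`IsEtaHamiltonianPair.extD_apply`). The tangent space splits as `ker η`
plus the span of the Reeb vectors. For a smooth `Y` in `ker η`, the formula `dη(X, Y) = X η(Y) - Y
η(X) - η([X, Y])` loses its first and last terms and leaves `Y f`. On a Reeb vector both sides
vanish.

The same formula for two such fields then gives `η([X_f, X_g]) = dη(X_f, X_g) = df(X_g)`.
Antisymmetry and bilinearity of the bracket follow. Since `X_{{f, g}} = -[X_f, X_g]`, its Jacobi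
identity is that of vector fields evaluated by `η`.

Applying `θ`, `X_f` is a Hamiltonian field of `⟨f, θ⟩` for `ω`, and the two brackets correspond
(`poissonBracket_pair`), so the Lie algebra structure passes to the image. If `C` commutes with the
image, then `0 = ω(v, X_f) = dC(X_f)` for any `v` with `ι_v ω = dC`.

Two technical inputs carry this: `inChart_extD`, by which the exterior derivative may be computed in
any chart (hence `ω = d⟨η, θ⟩` is closed), and `exists_smoothVF_mem_ker`, which extends a vector of
`ker η` to a global smooth section. -/

theorem two_le_infty : minSmoothness ℝ 2 ≤ (∞ : WithTop ℕ∞) := by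
  rw [minSmoothness_of_isRCLikeNormedField]
  exact WithTop.coe_le_coe.2 le_top

/-! ### Exterior derivative in charts; `d² = 0`. -/

section Charts

variable {E : Type*} [NormedAddCommGroup E] [NormedSpace ℝ E]
variable {M : Type*} [TopologicalSpace M] [ChartedSpace E M]
variable {F : Type*} [NormedAddCommGroup F] [NormedSpace ℝ F]

/-- The base point occurs in the type of the form's value, which blocks rewriting along `p = q`;
fixing the inner map as an endomorphism of `E` removes this dependence. -/
theorem DForm.comp_congr {n : ℕ} (Ω : DForm E M F n) {p q : M} (h : p = q) (A : E →L[ℝ] E) :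
    (Ω p).compContinuousLinearMap (A : E →L[ℝ] TangentSpace 𝓘(ℝ, E) p) =
      (Ω q).compContinuousLinearMap (A : E →L[ℝ] TangentSpace 𝓘(ℝ, E) q) := by
  subst h; rfl

theorem inChart_extChartAt {n : ℕ} (Ω : DForm E M F n) (x₀ : M) {q : M}
    (hq : q ∈ (extChartAt 𝓘(ℝ, E) x₀).source) :
    inChart Ω x₀ (extChartAt 𝓘(ℝ, E) x₀ q) = (Ω q).compContinuousLinearMap
      (mfderiv 𝓘(ℝ, E) 𝓘(ℝ, E) (extChartAt 𝓘(ℝ, E) x₀).symm (extChartAt 𝓘(ℝ, E) x₀ q) :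
        E →L[ℝ] E) :=
  DForm.comp_congr Ω ((extChartAt 𝓘(ℝ, E) x₀).left_inv hq) _

theorem isOpen_transition_source (x₀ x₁ : M) :
    IsOpen ((extChartAt 𝓘(ℝ, E) x₀).target ∩
      (extChartAt 𝓘(ℝ, E) x₀).symm ⁻¹' (extChartAt 𝓘(ℝ, E) x₁).source) :=
  (continuousOn_extChartAt_symm x₀).isOpen_inter_preimage (isOpen_extChartAt_target x₀)
    (isOpen_extChartAt_source x₁)

theorem SmoothForm.contDiffAt {n : ℕ} {Ω : DForm E M F n} (hΩ : SmoothForm Ω) (x₀ : M) {y : E}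
    (hy : y ∈ (extChartAt 𝓘(ℝ, E) x₀).target) : ContDiffAt ℝ ∞ (inChart Ω x₀) y :=
  (hΩ x₀).contDiffAt ((isOpen_extChartAt_target x₀).mem_nhds hy)

theorem SmoothForm.pairForm {n : ℕ} {β : DForm E M F n} (hβ : SmoothForm β) (θ : F →L[ℝ] ℝ) :
    SmoothForm (pairForm β θ) := fun x₀ =>
  (ContinuousLinearMap.compContinuousAlternatingMapCLM ℝ E F ℝ (Fin n) θ).contDiff.comp_contDiffOn (hβ x₀)

/-- `θ` is a fixed continuous linear map, so it commutes with the derivative and with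
alternatization. -/
theorem extD_pairForm {n : ℕ} {β : DForm E M F n} (hβ : SmoothForm β) (θ : F →L[ℝ] ℝ) :
    KContact.extD (KContact.pairForm β θ) = KContact.pairForm (KContact.extD β) θ := by
  funext x
  have hd : DifferentiableAt ℝ (inChart β x) (extChartAt 𝓘(ℝ, E) x x) :=
    (hβ.contDiffAt x (mem_extChartAt_target x)).differentiableAt (by simp)
  let T := ContinuousLinearMap.compContinuousAlternatingMapCLM ℝ E F ℝ (Fin n) θ
  have h1 : inChart (KContact.pairForm β θ) x = T ∘ inChart β x := rfl
  have h2 : extDeriv (inChart (KContact.pairForm β θ) x) (extChartAt 𝓘(ℝ, E) x x) =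
      θ.compContinuousAlternatingMap (extDeriv (inChart β x) (extChartAt 𝓘(ℝ, E) x x)) := by
    ext v
    rw [h1, extDeriv, fderiv_comp _ T.differentiableAt hd, ContinuousLinearMap.fderiv]
    simp [extDeriv, ContinuousAlternatingMap.alternatizeUncurryFin_apply, T]
  rw [KContact.extD, h2]
  rfl

variable [IsManifold 𝓘(ℝ, E) ∞ M]

theorem isManifold_one : IsManifold 𝓘(ℝ, E) 1 M := .of_le (n := ∞) (by decide)

theorem mfderiv_symm_comp_extChartAt (x₀ : M) {q : M}
    (hq : q ∈ (extChartAt 𝓘(ℝ, E) x₀).source) (v : E) :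
    (mfderiv 𝓘(ℝ, E) 𝓘(ℝ, E) (extChartAt 𝓘(ℝ, E) x₀).symm (extChartAt 𝓘(ℝ, E) x₀ q) : E →L[ℝ] E)
      ((mfderiv 𝓘(ℝ, E) 𝓘(ℝ, E) (extChartAt 𝓘(ℝ, E) x₀) q : E →L[ℝ] E) v) = v := by
  have := isManifold_one (E := E) (M := M)
  have h := mfderivWithin_extChartAt_symm_comp_mfderiv_extChartAt' (I := 𝓘(ℝ, E)) hq
  rw [ModelWithCorners.range_eq_univ, mfderivWithin_univ] at h
  exact congrArg (fun L : E →L[ℝ] E => L v) h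

theorem mdifferentiableAt_extChartAt_symm (x₀ : M) {y : E}
    (hy : y ∈ (extChartAt 𝓘(ℝ, E) x₀).target) :
    MDifferentiableAt 𝓘(ℝ, E) 𝓘(ℝ, E) (extChartAt 𝓘(ℝ, E) x₀).symm y := by
  have := isManifold_one (E := E) (M := M)
  have h := mdifferentiableWithinAt_extChartAt_symm (I := 𝓘(ℝ, E)) hy
  rwa [ModelWithCorners.range_eq_univ, mdifferentiableWithinAt_univ] at h

theorem fderiv_transition (x₀ x₁ : M) {y : E} (hy : y ∈ (extChartAt 𝓘(ℝ, E) x₀).target)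
    (hy' : (extChartAt 𝓘(ℝ, E) x₀).symm y ∈ (extChartAt 𝓘(ℝ, E) x₁).source) (v : E) :
    fderiv ℝ (extChartAt 𝓘(ℝ, E) x₁ ∘ (extChartAt 𝓘(ℝ, E) x₀).symm) y v =
      (mfderiv 𝓘(ℝ, E) 𝓘(ℝ, E) (extChartAt 𝓘(ℝ, E) x₁) ((extChartAt 𝓘(ℝ, E) x₀).symm y) :
          E →L[ℝ] E)
        ((mfderiv 𝓘(ℝ, E) 𝓘(ℝ, E) (extChartAt 𝓘(ℝ, E) x₀).symm y : E →L[ℝ] E) v) := by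
  have := isManifold_one (E := E) (M := M)
  rw [← mfderiv_eq_fderiv]
  rw [extChartAt_source] at hy'
  rw [mfderiv_comp y (mdifferentiableAt_extChartAt hy') (mdifferentiableAt_extChartAt_symm x₀ hy)]
  rfl

theorem contDiffAt_transition (x₀ x₁ : M) {y : E} (hy : y ∈ (extChartAt 𝓘(ℝ, E) x₀).target)
    (hy' : (extChartAt 𝓘(ℝ, E) x₀).symm y ∈ (extChartAt 𝓘(ℝ, E) x₁).source) :
    ContDiffAt ℝ ∞ (extChartAt 𝓘(ℝ, E) x₁ ∘ (extChartAt 𝓘(ℝ, E) x₀).symm) y := by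
  have h₀ : ContMDiffAt 𝓘(ℝ, E) 𝓘(ℝ, E) ∞ (extChartAt 𝓘(ℝ, E) x₀).symm y :=
    (contMDiffOn_extChartAt_symm x₀).contMDiffAt ((isOpen_extChartAt_target x₀).mem_nhds hy)
  rw [extChartAt_source] at hy'
  exact ((contMDiffAt_extChartAt' hy').comp y h₀).contDiffAt

theorem inChart_eq_pullback {n : ℕ} (Ω : DForm E M F n) (x₀ x₁ : M) {y : E}
    (hy : y ∈ (extChartAt 𝓘(ℝ, E) x₀).target)
    (hy' : (extChartAt 𝓘(ℝ, E) x₀).symm y ∈ (extChartAt 𝓘(ℝ, E) x₁).source) :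
    inChart Ω x₀ y =
      (inChart Ω x₁ ((extChartAt 𝓘(ℝ, E) x₁ ∘ (extChartAt 𝓘(ℝ, E) x₀).symm) y)).compContinuousLinearMap
        (fderiv ℝ (extChartAt 𝓘(ℝ, E) x₁ ∘ (extChartAt 𝓘(ℝ, E) x₀).symm) y) := by
  rw [Function.comp_apply, inChart_extChartAt Ω x₁ hy']
  ext v
  refine congrArg (Ω ((extChartAt 𝓘(ℝ, E) x₀).symm y)) (funext fun i => ?_)
  refine (mfderiv_symm_comp_extChartAt x₁ hy' _).symm.trans ?_
  exact congrArg _ (fderiv_transition x₀ x₁ hy hy' (v i)).symm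

/-- `extD` uses a different chart at each point, so it cannot be differentiated directly. Near `y`
the form is a pullback of its expression in the chart around `x₁` by the transition map, and
`extDeriv` is natural under pullback. -/
theorem inChart_extD {n : ℕ} {Ω : DForm E M F n} (hΩ : SmoothForm Ω) (x₀ : M) {y : E}
    (hy : y ∈ (extChartAt 𝓘(ℝ, E) x₀).target) :
    inChart (extD Ω) x₀ y = extDeriv (inChart Ω x₀) y := by
  set x₁ := (extChartAt 𝓘(ℝ, E) x₀).symm y with hx₁
  have hy' : (extChartAt 𝓘(ℝ, E) x₀).symm y ∈ (extChartAt 𝓘(ℝ, E) x₁).source :=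
    mem_extChartAt_source x₁
  have hev : inChart Ω x₀ =ᶠ[𝓝 y] fun z =>
      (inChart Ω x₁ ((extChartAt 𝓘(ℝ, E) x₁ ∘ (extChartAt 𝓘(ℝ, E) x₀).symm) z)).compContinuousLinearMap
        (fderiv ℝ (extChartAt 𝓘(ℝ, E) x₁ ∘ (extChartAt 𝓘(ℝ, E) x₀).symm) z) := by
    filter_upwards [(isOpen_transition_source x₀ x₁).mem_nhds ⟨hy, hy'⟩] with z hz
    exact inChart_eq_pullback Ω x₀ x₁ hz.1 hz.2
  rw [hev.extDeriv_eq, extDeriv_pullback (r := ∞)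
    (f := extChartAt 𝓘(ℝ, E) x₁ ∘ (extChartAt 𝓘(ℝ, E) x₀).symm)
    ((hΩ.contDiffAt x₁ ((extChartAt 𝓘(ℝ, E) x₁).map_source hy')).differentiableAt (by simp))
    (contDiffAt_transition x₀ x₁ hy hy') two_le_infty]
  ext v
  refine congrArg (extDeriv (inChart Ω x₁) (extChartAt 𝓘(ℝ, E) x₁ x₁)) (funext fun i => ?_)
  exact (fderiv_transition x₀ x₁ hy hy' (v i)).symm

theorem SmoothForm.extD {n : ℕ} {Ω : DForm E M F n} (hΩ : SmoothForm Ω) :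
    SmoothForm (extD Ω) := by
  intro x₀
  have h : ContDiffOn ℝ ∞ (extDeriv (inChart Ω x₀)) (extChartAt 𝓘(ℝ, E) x₀).target := by
    intro y hy
    refine ContDiffAt.contDiffWithinAt ?_
    exact (ContinuousAlternatingMap.alternatizeUncurryFinCLM ℝ E F).contDiff.contDiffAt.comp y
      ((hΩ.contDiffAt x₀ hy).fderiv_right (m := ∞) le_rfl)
  exact h.congr fun y hy => inChart_extD hΩ x₀ hy

theorem extD_extD {n : ℕ} {Ω : DForm E M F n} (hΩ : SmoothForm Ω) :
    KContact.extD (KContact.extD Ω) = 0 := by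
  funext x
  have hx := mem_extChartAt_target (I := 𝓘(ℝ, E)) x
  have hev : inChart (KContact.extD Ω) x =ᶠ[𝓝 (extChartAt 𝓘(ℝ, E) x x)] extDeriv (inChart Ω x) := by
    filter_upwards [(isOpen_extChartAt_target (I := 𝓘(ℝ, E)) x).mem_nhds hx] with y hy
    exact inChart_extD hΩ x hy
  have h0 : extDeriv (inChart (KContact.extD Ω) x) (extChartAt 𝓘(ℝ, E) x x) = 0 := by
    rw [hev.extDeriv_eq, extDeriv_extDeriv_apply (r := ∞) (hΩ.contDiffAt x hx) two_le_infty]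
  rw [KContact.extD, h0]
  rfl

end Charts

/-! ### Vector fields in charts and the invariant formula for `dη(X, Y)`. -/

section VectorFields

variable {E : Type*} [NormedAddCommGroup E] [NormedSpace ℝ E]
variable {M : Type*} [TopologicalSpace M] [ChartedSpace E M]
variable {F : Type*} [NormedAddCommGroup F] [NormedSpace ℝ F]

theorem extDeriv_oneForm_apply_vectorField {α : E → E [⋀^Fin 1]→L[ℝ] F} {V W : E → E} {y : E}
    (hα : DifferentiableAt ℝ α y) (hV : DifferentiableAt ℝ V y) (hW : DifferentiableAt ℝ W y) :
    extDeriv α y ![V y, W y] = fderiv ℝ (fun z => α z ![W z]) y (V y) -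
      fderiv ℝ (fun z => α z ![V z]) y (W y) - α y ![lieBracket ℝ V W y] := by
  have h := extDeriv_apply_vectorField (V := ![V, W]) hα (fun i => by fin_cases i <;> assumption)
  have e : (fun i => ![V, W] i y) = ![V y, W y] := by
    funext i; fin_cases i <;> rfl
  have e0 (z : E) : Fin.removeNth 0 (fun i => ![V, W] i z) = ![W z] := by
    funext i; fin_cases i; rfl
  have e1 (z : E) : Fin.removeNth 1 (fun i => ![V, W] i z) = ![V z] := by
    funext i; fin_cases i; rfl
  rw [e, Fin.sum_univ_two] at h
  simp only [e0, e1] at h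
  rw [h]
  simp [sub_eq_add_neg]

/-- The expression of a vector field in the preferred chart around `x₀`. -/
def chartVF (X : VField E M) (x₀ : M) : E → E :=
  mpullbackWithin 𝓘(ℝ, E) 𝓘(ℝ, E) (extChartAt 𝓘(ℝ, E) x₀).symm X (range 𝓘(ℝ, E))

/-- The expression in a chart of a one-form, as a field of continuous linear maps. -/
def oneFormCLM (η : DForm E M F 1) (x₀ : M) (y : E) : E →L[ℝ] F :=
  (ContinuousAlternatingMap.ofSubsingletonLIE (𝕜 := ℝ) (E := E) (F := F) (0 : Fin 1)).symm (inChart η x₀ y)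

theorem oneFormCLM_apply (η : DForm E M F 1) (x₀ : M) (y v : E) :
    oneFormCLM η x₀ y v = inChart η x₀ y ![v] := by
  refine congrArg (inChart η x₀ y) (funext fun i => ?_)
  fin_cases i
  rfl

theorem contDiffAt_oneFormCLM {η : DForm E M F 1} (hη : SmoothForm η) (x₀ : M) {y : E}
    (hy : y ∈ (extChartAt 𝓘(ℝ, E) x₀).target) : ContDiffAt ℝ ∞ (oneFormCLM η x₀) y :=
  (ContinuousAlternatingMap.ofSubsingletonLIE (𝕜 := ℝ) (E := E) (F := F) (0 : Fin 1)).symm.contDiff.contDiffAt.comp y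
    (hη.contDiffAt x₀ hy)

variable [IsManifold 𝓘(ℝ, E) ∞ M]

theorem mfderiv_symm_chartVF (X : VField E M) (x₀ : M) {y : E}
    (hy : y ∈ (extChartAt 𝓘(ℝ, E) x₀).target) :
    (mfderiv 𝓘(ℝ, E) 𝓘(ℝ, E) (extChartAt 𝓘(ℝ, E) x₀).symm y : E →L[ℝ] E) (chartVF (E := E) X x₀ y) =
      X ((extChartAt 𝓘(ℝ, E) x₀).symm y) := by
  have := isManifold_one (E := E) (M := M)
  have hinv := isInvertible_mfderivWithin_extChartAt_symm (I := 𝓘(ℝ, E)) hy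
  have h := hinv.self_apply_inverse (X ((extChartAt 𝓘(ℝ, E) x₀).symm y))
  rw [chartVF, mpullbackWithin_apply]
  rw [ModelWithCorners.range_eq_univ, mfderivWithin_univ] at h ⊢
  exact h

theorem inChart_chartVF (η : DForm E M F 1) (X : VField E M) (x₀ : M) {y : E}
    (hy : y ∈ (extChartAt 𝓘(ℝ, E) x₀).target) :
    inChart η x₀ y ![chartVF X x₀ y] =
      η ((extChartAt 𝓘(ℝ, E) x₀).symm y) ![X ((extChartAt 𝓘(ℝ, E) x₀).symm y)] := by
  refine congrArg (η ((extChartAt 𝓘(ℝ, E) x₀).symm y)) (funext fun i => ?_)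
  fin_cases i
  exact mfderiv_symm_chartVF X x₀ hy

theorem mfderiv_extChartAt_symm_self (x : M) (v : E) :
    (mfderiv 𝓘(ℝ, E) 𝓘(ℝ, E) (extChartAt 𝓘(ℝ, E) x).symm (extChartAt 𝓘(ℝ, E) x x) : E →L[ℝ] E) v
      = v := by
  have := isManifold_one (E := E) (M := M)
  have h := mfderivWithin_range_extChartAt_symm (I := 𝓘(ℝ, E)) (x := x)
  rw [ModelWithCorners.range_eq_univ, mfderivWithin_univ] at h
  exact congrArg (fun L : E →L[ℝ] E => L v) h

theorem inChart_self {n : ℕ} (Ω : DForm E M F n) (x : M) (v : Fin n → E) :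
    inChart Ω x (extChartAt 𝓘(ℝ, E) x x) v = Ω x v := by
  rw [inChart_extChartAt Ω x (mem_extChartAt_source x)]
  exact congrArg (Ω x) (funext fun i => mfderiv_extChartAt_symm_self x (v i))

theorem extD_apply_self {n : ℕ} (Ω : DForm E M F n) (x : M) (v : Fin (n + 1) → E) :
    extD Ω x v = extDeriv (inChart Ω x) (extChartAt 𝓘(ℝ, E) x x) v := by
  have := isManifold_one (E := E) (M := M)
  refine congrArg (extDeriv (inChart Ω x) (extChartAt 𝓘(ℝ, E) x x)) (funext fun i => ?_)
  have h := mfderiv_extChartAt_self (I := 𝓘(ℝ, E)) (x := x)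
  exact congrArg (fun L : E →L[ℝ] E => L (v i)) h

theorem chartVF_self (X : VField E M) (x : M) : chartVF X x (extChartAt 𝓘(ℝ, E) x x) = X x := by
  have h := mfderiv_symm_chartVF X x (mem_extChartAt_target x)
  rw [mfderiv_extChartAt_symm_self] at h
  rw [h]
  exact congrArg (fun z => (X z : E)) (extChartAt_to_inv x)

/-- The bracket is defined through the chart around `x`, whose derivative at `x` itself is the
identity of `E`. -/
theorem mlieBracket_eq_lieBracket_chartVF (X Y : VField E M) (x : M) :
    mlieBracket 𝓘(ℝ, E) X Y x =
      lieBracket ℝ (chartVF X x) (chartVF Y x) (extChartAt 𝓘(ℝ, E) x x) := by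
  have := isManifold_one (E := E) (M := M)
  have hid : (mfderiv 𝓘(ℝ, E) 𝓘(ℝ, E) (extChartAt 𝓘(ℝ, E) x) x : E →L[ℝ] E).inverse =
      ContinuousLinearMap.id ℝ E :=
    (congrArg (fun L : E →L[ℝ] E => L.inverse) (mfderiv_extChartAt_self (I := 𝓘(ℝ, E)))).trans
      ContinuousLinearMap.inverse_id
  have hs : (extChartAt 𝓘(ℝ, E) x).symm ⁻¹' univ ∩ range 𝓘(ℝ, E) = univ := by
    rw [ModelWithCorners.range_eq_univ, preimage_univ, inter_univ]
  rw [← mlieBracketWithin_univ, mlieBracketWithin_apply, hs, ← lieBracketWithin_univ]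
  exact congrArg (fun L : E →L[ℝ] E => L (lieBracketWithin ℝ (chartVF X x) (chartVF Y x) univ
    (extChartAt 𝓘(ℝ, E) x x))) hid

variable [CompleteSpace E]

theorem SmoothVF.contDiffAt_chartVF {X : VField E M} (hX : SmoothVF X) (x : M) :
    ContDiffAt ℝ ∞ (chartVF X x) (extChartAt 𝓘(ℝ, E) x x) := by
  have h := contMDiffWithinAt_mpullbackWithin_extChartAt_symm (I := 𝓘(ℝ, E)) (n := ∞) (m := ∞)
    (s := univ) (x := x) (hX x).contMDiffWithinAt uniqueMDiffOn_univ (mem_univ x) le_rfl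
  rw [preimage_univ, inter_univ] at h
  exact (contMDiffWithinAt_vectorSpace_iff_contDiffWithinAt.1 h).contDiffAt
    ((isOpen_extChartAt_target x).mem_nhds (mem_extChartAt_target x))

theorem contDiffAt_inChart_chartVF {η : DForm E M F 1} (hη : SmoothForm η) {X : VField E M}
    (hX : SmoothVF X) (x : M) :
    ContDiffAt ℝ ∞ (fun y => inChart η x y ![chartVF X x y]) (extChartAt 𝓘(ℝ, E) x x) := by
  simp only [← oneFormCLM_apply]
  exact (contDiffAt_oneFormCLM hη x (mem_extChartAt_target x)).clm_apply (hX.contDiffAt_chartVF x)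

theorem contMDiff_form_apply {η : DForm E M F 1} (hη : SmoothForm η) {X : VField E M}
    (hX : SmoothVF X) : ContMDiff 𝓘(ℝ, E) 𝓘(ℝ, F) ∞ (fun z => η z ![X z]) := by
  intro x
  have h := (contDiffAt_inChart_chartVF hη hX x).contMDiffAt.comp x
    (contMDiffAt_extChartAt (I := 𝓘(ℝ, E)) (n := ∞))
  refine h.congr_of_eventuallyEq ?_
  filter_upwards [extChartAt_source_mem_nhds (I := 𝓘(ℝ, E)) x] with z hz
  have h2 := inChart_chartVF η X x ((extChartAt 𝓘(ℝ, E) x).map_source hz)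
  rw [(extChartAt 𝓘(ℝ, E) x).left_inv hz] at h2
  exact h2.symm

theorem mfderiv_form_apply {η : DForm E M F 1} (hη : SmoothForm η) {X : VField E M}
    (hX : SmoothVF X) (x : M) (v : E) :
    mvfderiv 𝓘(ℝ, E) (fun z => η z ![X z]) x v =
      fderiv ℝ (fun y => inChart η x y ![chartVF X x y]) (extChartAt 𝓘(ℝ, E) x x) v := by
  rw [mvfderiv, ((contMDiff_form_apply hη hX x).mdifferentiableAt (by simp)).mfderiv,
    ModelWithCorners.range_eq_univ, fderivWithin_univ]
  refine congrArg (fun L : E →L[ℝ] F => L v) (Filter.EventuallyEq.fderiv_eq ?_)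
  filter_upwards [(isOpen_extChartAt_target (I := 𝓘(ℝ, E)) x).mem_nhds
    (mem_extChartAt_target x)] with y hy
  exact (inChart_chartVF η X x hy).symm

/-- The invariant formula for the exterior derivative of a one-form. -/
theorem extD_apply_vectorField {η : DForm E M F 1} (hη : SmoothForm η) {X Y : VField E M}
    (hX : SmoothVF X) (hY : SmoothVF Y) (x : M) :
    extD η x ![X x, Y x] =
      (mvfderiv 𝓘(ℝ, E) (fun z => η z ![Y z]) x (X x)) -
      (mvfderiv 𝓘(ℝ, E) (fun z => η z ![X z]) x (Y x)) -
      η x ![mlieBracket 𝓘(ℝ, E) X Y x] := by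
  have h := extDeriv_oneForm_apply_vectorField
    ((hη.contDiffAt x (mem_extChartAt_target x)).differentiableAt (by simp))
    ((hX.contDiffAt_chartVF x).differentiableAt (by simp))
    ((hY.contDiffAt_chartVF x).differentiableAt (by simp))
  rw [chartVF_self, chartVF_self] at h
  rw [mlieBracket_eq_lieBracket_chartVF]
  refine (extD_apply_self η x ![X x, Y x]).trans (h.trans ?_)
  exact congrArg₂ (· - ·) (congrArg₂ (· - ·) (mfderiv_form_apply hη hY x (X x)).symm
    (mfderiv_form_apply hη hX x (Y x)).symm) (inChart_self η x _)

end VectorFields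

/-! ### Pointwise linear algebra of a `k`-contact form. -/

section Linear

variable {E : Type*} [NormedAddCommGroup E] [NormedSpace ℝ E]
variable {M : Type*} [TopologicalSpace M] [ChartedSpace E M]
variable {F : Type*} [NormedAddCommGroup F] [NormedSpace ℝ F]

/-- The value of a one-form at a point, as a linear map. -/
def evalOne (η : DForm E M F 1) (x : M) : TangentSpace 𝓘(ℝ, E) x →ₗ[ℝ] F where
  toFun v := η x ![v]
  map_add' v w := (η x).map_vecCons_add ![] v w
  map_smul' c v := (η x).map_vecCons_smul ![] c v

theorem twoForm_swap (Ω : DForm E M F 2) (x : M) (a b : TangentSpace 𝓘(ℝ, E) x) :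
    Ω x ![a, b] = - Ω x ![b, a] := by
  have h : Ω x (![b, a] ∘ Equiv.swap 0 1) = - Ω x ![b, a] :=
    (Ω x).map_swap ![b, a] (i := 0) (j := 1) (by decide)
  have e : ![b, a] ∘ Equiv.swap 0 1 = ![a, b] := by
    funext i
    fin_cases i <;> simp
  rw [← h, e]

/-- The value of a two-form at a point, as a bilinear map. -/
def evalTwo (Ω : DForm E M F 2) (x : M) :
    TangentSpace 𝓘(ℝ, E) x →ₗ[ℝ] TangentSpace 𝓘(ℝ, E) x →ₗ[ℝ] F :=
  LinearMap.mk₂ ℝ (fun v w => Ω x ![v, w])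
    (fun v v' w => (Ω x).map_vecCons_add ![w] v v')
    (fun c v w => (Ω x).map_vecCons_smul ![w] c v)
    (fun v w w' => by
      rw [twoForm_swap, twoForm_swap Ω x v w, twoForm_swap Ω x v w', ← neg_add]
      exact congrArg _ ((Ω x).map_vecCons_add ![v] w w'))
    (fun c v w => by
      rw [twoForm_swap, twoForm_swap Ω x v w, smul_neg]
      exact congrArg _ ((Ω x).map_vecCons_smul ![v] c w))

theorem evalTwo_apply (Ω : DForm E M F 2) (x : M) (v w : TangentSpace 𝓘(ℝ, E) x) :
    evalTwo Ω x v w = Ω x ![v, w] := rfl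

variable {k : ℕ} {η : DForm E M (Fin k → ℝ) 1}

/-- Since `η(R_α)` is the `α`-th basis vector, subtracting the Reeb component kills `η`; this is the
splitting of the tangent space. -/
theorem sub_sum_reeb_mem_ker [FiniteDimensional ℝ E] (hη : IsKContactForm η) (x : M)
    (w : TangentSpace 𝓘(ℝ, E) x) :
    w - ∑ α, evalOne η x w α • reeb η α x ∈ ker₁ η x := by
  change evalOne η x (w - ∑ α, evalOne η x w α • reeb η α x) = 0
  have h (α : Fin k) : evalOne η x (reeb η α x) = Pi.single α 1 := (isReebVector_reeb hη α x).1
  rw [map_sub, map_sum]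
  simp only [map_smul, h]
  rw [sub_eq_zero]
  funext i
  simp [Finset.sum_apply, Pi.single_apply]

/-- Linear maps that agree on the contact distribution and on the Reeb vectors are equal. -/
theorem eq_of_ker_of_reeb [FiniteDimensional ℝ E] (hη : IsKContactForm η) {x : M}
    {A B : TangentSpace 𝓘(ℝ, E) x →ₗ[ℝ] F} (hker : ∀ v ∈ ker₁ η x, A v = B v)
    (hreeb : ∀ α, A (reeb η α x) = B (reeb η α x)) : A = B := by
  ext w
  have h := hker _ (sub_sum_reeb_mem_ker hη x w)
  simp only [map_sub, map_sum, map_smul, hreeb] at h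
  exact sub_left_injective h

/-- The difference lies in `ker η ∩ ker dη = 0`. -/
theorem IsKContactForm.eq_of_eval (hη : IsKContactForm η) {x : M} {v w : TangentSpace 𝓘(ℝ, E) x}
    (h₁ : η x ![v] = η x ![w]) (h₂ : ∀ u, extD η x ![v, u] = extD η x ![w, u]) : v = w := by
  have h : v - w ∈ ker₁ η x ⊓ ker₂ (extD η) x := by
    refine ⟨?_, fun u => ?_⟩
    · change evalOne η x (v - w) = 0
      rw [map_sub, sub_eq_zero]
      exact h₁
    · change evalTwo (extD η) x (v - w) u = 0
      rw [map_sub, LinearMap.sub_apply, sub_eq_zero]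
      exact h₂ u
  rw [hη.ker_inf_ker x] at h
  exact sub_eq_zero.1 h

end Linear

/-! ### Local and global sections of `ker η`. -/

section Pullback

variable {E : Type*} [NormedAddCommGroup E] [NormedSpace ℝ E]
variable {M : Type*} [TopologicalSpace M] [ChartedSpace E M]
variable [IsManifold 𝓘(ℝ, E) ∞ M]
variable {F : Type*} [NormedAddCommGroup F] [NormedSpace ℝ F]

/-- A one-form on a vector field given in a chart, computed in that chart. -/
theorem form_mpullback_extChartAt (η : DForm E M F 1) (x : M) {z : M}
    (hz : z ∈ (extChartAt 𝓘(ℝ, E) x).source) (V : E → E) :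
    η z ![mpullback 𝓘(ℝ, E) 𝓘(ℝ, E) (extChartAt 𝓘(ℝ, E) x) V z] =
      oneFormCLM η x (extChartAt 𝓘(ℝ, E) x z) (V (extChartAt 𝓘(ℝ, E) x z)) := by
  have := isManifold_one (E := E) (M := M)
  rw [oneFormCLM_apply, inChart_extChartAt η x hz]
  refine congrArg (η z) (funext fun i => ?_)
  fin_cases i
  have h := (isInvertible_mfderiv_extChartAt (I := 𝓘(ℝ, E)) hz).self_apply_inverse
    (V (extChartAt 𝓘(ℝ, E) x z))
  have h2 := mfderiv_symm_comp_extChartAt x hz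
    (mpullback 𝓘(ℝ, E) 𝓘(ℝ, E) (extChartAt 𝓘(ℝ, E) x) V z)
  refine h2.symm.trans (congrArg _ h)

end Pullback

/-- A smooth field of surjections annihilates a local smooth field through each kernel vector. -/
theorem exists_contDiff_mem_ker {E : Type*} [NormedAddCommGroup E] [NormedSpace ℝ E]
    {G : Type*} [NormedAddCommGroup G] [NormedSpace ℝ G]
    [CompleteSpace G] {L : E → E →L[ℝ] G} {U : Set E} (hU : IsOpen U)
    (hL : ∀ y ∈ U, ContDiffAt ℝ ∞ L y) {y₀ : E} (hy₀ : y₀ ∈ U) {S : G →L[ℝ] E}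
    (hS : L y₀ ∘L S = 1) {v : E} (hv : L y₀ v = 0) :
    ∃ (V : E → E) (U' : Set E), IsOpen U' ∧ y₀ ∈ U' ∧ U' ⊆ U ∧ (∀ y ∈ U', ContDiffAt ℝ ∞ V y) ∧
      (∀ y ∈ U', L y (V y) = 0) ∧ V y₀ = v := by
  have hA : ∀ y ∈ U, ContDiffAt ℝ ∞ (fun y => L y ∘L S) y := fun y hy =>
    (hL y hy).clm_comp contDiffAt_const
  -- This is the projection of `v` onto `ker (L y)` along the range of `S`. It makes sense where `L
  -- y ∘L S` is invertible, an open condition that holds at `y₀`; there `L y₀ v = 0`, so `v` is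
  -- unchanged.
  refine ⟨fun y => v - S (Ring.inverse (L y ∘L S) (L y v)),
    U ∩ (fun y => L y ∘L S) ⁻¹' {A | IsUnit A}, ?_, ⟨hy₀, ?_⟩, inter_subset_left, ?_, ?_, ?_⟩
  · exact ContinuousOn.isOpen_inter_preimage
      (fun y hy => (hA y hy).continuousAt.continuousWithinAt) hU Units.isOpen
  · rw [mem_preimage, hS]
    exact isUnit_one
  · rintro y ⟨hy, u, hu⟩
    refine contDiffAt_const.sub (S.contDiff.contDiffAt.comp y ?_)
    refine ContDiffAt.clm_apply ?_ ((hL y hy).clm_apply contDiffAt_const)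
    have hinv : ContDiffAt ℝ ∞ Ring.inverse (L y ∘L S) := by
      have h := contDiffAt_ringInverse ℝ (n := ∞) u
      rwa [hu] at h
    exact ContDiffAt.comp y hinv (hA y hy)
  · rintro y ⟨hy, hu⟩
    have h := congrArg (fun B : G →L[ℝ] G => B (L y v)) (Ring.mul_inverse_cancel _ hu)
    simp only [mul_apply_eq_comp, ContinuousLinearMap.comp_apply,
      one_apply_eq_self] at h
    rw [map_sub, h, sub_self]
  · simp [hv]

section Extension

variable {E : Type*} [NormedAddCommGroup E] [NormedSpace ℝ E] [FiniteDimensional ℝ E]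
variable {M : Type*} [TopologicalSpace M] [ChartedSpace E M]
variable [IsManifold 𝓘(ℝ, E) ∞ M]
variable {k : ℕ} {η : DForm E M (Fin k → ℝ) 1}
variable [T2Space M]

/-- The Hamiltonian condition tests only global smooth fields, so each kernel vector needs a global
extension. A local section built in a chart is cut off by a bump function, which preserves
membership in `ker η`. -/
theorem exists_smoothVF_mem_ker (hη : IsKContactForm η) {x : M} {v : TangentSpace 𝓘(ℝ, E) x}
    (hv : v ∈ ker₁ η x) :
    ∃ Y : VField E M, SmoothVF Y ∧ (∀ z, Y z ∈ ker₁ η z) ∧ Y x = v := by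
  have := isManifold_one (E := E) (M := M)
  have : CompleteSpace E := FiniteDimensional.complete ℝ E
  have hself (w : E) : oneFormCLM η x (extChartAt 𝓘(ℝ, E) x x) w = evalOne η x w := by
    rw [oneFormCLM_apply, inChart_self]; rfl
  obtain ⟨R, hR⟩ : ∃ R : Fin k → E, ∀ α,
      oneFormCLM η x (extChartAt 𝓘(ℝ, E) x x) (R α) = Pi.single α 1 :=
    ⟨fun α => reeb η α x, fun α => (hself _).trans (isReebVector_reeb hη α x).1⟩
  -- The Reeb vectors at `x` are dual to the components of `η`, so they provide a right inverse of
  -- `η x`.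
  let S : (Fin k → ℝ) →L[ℝ] E :=
    ∑ α, (ContinuousLinearMap.proj (R := ℝ) (φ := fun _ : Fin k => ℝ) α).smulRight (R α)
  have hS : oneFormCLM η x (extChartAt 𝓘(ℝ, E) x x) ∘L S = 1 := by
    ext1 c
    have e : S c = ∑ α, c α • R α := by simp [S]
    rw [ContinuousLinearMap.comp_apply, e, map_sum, one_apply_eq_self]
    simp only [map_smul, hR]
    funext i
    simp [Finset.sum_apply, Pi.single_apply]
  obtain ⟨V, U, hUo, hxU, hUt, hVs, hV0, hVx⟩ := exists_contDiff_mem_ker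
    (isOpen_extChartAt_target (I := 𝓘(ℝ, E)) x)
    (fun y hy => contDiffAt_oneFormCLM hη.smooth x hy) (mem_extChartAt_target x) hS
    ((hself v).trans hv)
  set N : Set M := (extChartAt 𝓘(ℝ, E) x).source ∩ extChartAt 𝓘(ℝ, E) x ⁻¹' U with hN
  have hNo : IsOpen N := (continuousOn_extChartAt x).isOpen_inter_preimage
    (isOpen_extChartAt_source x) hUo
  obtain ⟨b, -, hb⟩ := (SmoothBumpFunction.nhds_basis_tsupport (I := 𝓘(ℝ, E)) x).mem_iff.1
    (hNo.mem_nhds ⟨mem_extChartAt_source x, hxU⟩)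
  set Z : VField E M := mpullback 𝓘(ℝ, E) 𝓘(ℝ, E) (extChartAt 𝓘(ℝ, E) x) V with hZ
  have hZs : ContMDiffOn 𝓘(ℝ, E) 𝓘(ℝ, E).tangent ∞
      (fun z => (⟨z, Z z⟩ : TangentBundle 𝓘(ℝ, E) M)) N := by
    intro z hz
    refine ContMDiffAt.contMDiffWithinAt ?_
    refine ContMDiffAt.mpullback_vectorField_preimage (n := ∞) ?_
      (contMDiffAt_extChartAt' (by simpa using hz.1)) (isInvertible_mfderiv_extChartAt hz.1) le_rfl
    exact contMDiffAt_vectorSpace_iff_contDiffAt.2 (hVs _ hz.2)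
  refine ⟨(b : M → ℝ) • Z, ?_, fun z => ?_, ?_⟩
  · exact ContMDiffOn.smul_section_of_tsupport b.contMDiff.contMDiffOn hNo hb hZs
  · change evalOne η z (b z • Z z) = 0
    by_cases hz : z ∈ N
    · have h0 : evalOne η z (Z z) = 0 :=
        (form_mpullback_extChartAt η x hz.1 V).trans (hV0 _ hz.2)
      rw [map_smul, h0, smul_zero]
    · rw [image_eq_zero_of_notMem_tsupport (fun h => hz (hb h)), zero_smul, map_zero]
  · change b x • Z x = v
    rw [b.eq_one, one_smul]
    have hid : (mfderiv 𝓘(ℝ, E) 𝓘(ℝ, E) (extChartAt 𝓘(ℝ, E) x) x : E →L[ℝ] E).inverse =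
        ContinuousLinearMap.id ℝ E :=
      (congrArg (fun L : E →L[ℝ] E => L.inverse) (mfderiv_extChartAt_self (I := 𝓘(ℝ, E)))).trans
        ContinuousLinearMap.inverse_id
    exact (congrArg (fun L : E →L[ℝ] E => L (V (extChartAt 𝓘(ℝ, E) x x))) hid).trans hVx

end Extension

/-! ### Hamiltonian vector fields and their brackets. -/

section Hamiltonian

variable {E : Type*} [NormedAddCommGroup E] [NormedSpace ℝ E]
variable {M : Type*} [TopologicalSpace M] [ChartedSpace E M]
variable [IsManifold 𝓘(ℝ, E) ∞ M]
variable {k : ℕ} {η : DForm E M (Fin k → ℝ) 1} {X Y : VField E M} {f g : M → (Fin k → ℝ)}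

theorem SmoothVF.neg (hX : SmoothVF X) : SmoothVF (-X) :=
  ContMDiff.neg_section hX

theorem IsEtaHamiltonianPair.eq_neg (h : IsEtaHamiltonianPair η X f) :
    f = -fun z => η z ![X z] := funext h.2

theorem isEtaHamiltonianPair_etaHamVF (hf : IsEtaHamiltonianKFun η f) :
    IsEtaHamiltonianPair η (etaHamVF η f) f :=
  Classical.epsilon_spec (p := fun X => IsEtaHamiltonianPair η X f) hf

variable [FiniteDimensional ℝ E]

theorem SmoothVF.mlieBracket (hX : SmoothVF X) (hY : SmoothVF Y) :
    SmoothVF (mlieBracket 𝓘(ℝ, E) X Y) := by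
  have : CompleteSpace E := FiniteDimensional.complete ℝ E
  have : IsManifold 𝓘(ℝ, E) (minSmoothness ℝ 2) M := .of_le (n := ∞) two_le_infty
  -- Here `∞ + 1 = ∞`, so the derivative lost in forming the bracket costs nothing.
  have : IsManifold 𝓘(ℝ, E) (((⊤ : ℕ∞) : WithTop ℕ∞) + 1) M :=
    inferInstanceAs (IsManifold 𝓘(ℝ, E) ∞ M)
  exact ContDiff.mlieBracket_vectorField (m := ⊤) (n := ⊤) hX hY
    (by rw [minSmoothness_of_isRCLikeNormedField]; exact le_rfl)

theorem jacobi_mlieBracket {Z : VField E M} (hX : SmoothVF X) (hY : SmoothVF Y) (hZ : SmoothVF Z)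
    (x : M) :
    mlieBracket 𝓘(ℝ, E) X (mlieBracket 𝓘(ℝ, E) Y Z) x =
      mlieBracket 𝓘(ℝ, E) (mlieBracket 𝓘(ℝ, E) X Y) Z x +
        mlieBracket 𝓘(ℝ, E) Y (mlieBracket 𝓘(ℝ, E) X Z) x := by
  have : CompleteSpace E := FiniteDimensional.complete ℝ E
  have : IsManifold 𝓘(ℝ, E) (minSmoothness ℝ 3) M := .of_le (n := ∞)
    (by rw [minSmoothness_of_isRCLikeNormedField]; exact WithTop.coe_le_coe.2 le_top)
  exact leibniz_identity_mlieBracket_apply ((hX x).of_le two_le_infty)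
    ((hY x).of_le two_le_infty) ((hZ x).of_le two_le_infty)

theorem IsEtaHamiltonianPair.contMDiff (h : IsEtaHamiltonianPair η X f) (hη : SmoothForm η) :
    ContMDiff 𝓘(ℝ, E) 𝓘(ℝ, Fin k → ℝ) ∞ f := by
  have : CompleteSpace E := FiniteDimensional.complete ℝ E
  rw [h.eq_neg]
  exact (contMDiff_form_apply hη h.1.1).neg

/-- By Jacobi, `[[X, Y], Z] = [X, [Y, Z]] - [Y, [X, Z]]`, and both inner brackets are again sections
of `ker η`. -/
theorem IsEtaHamiltonianVF.mlieBracket (hX : IsEtaHamiltonianVF η X)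
    (hY : IsEtaHamiltonianVF η Y) : IsEtaHamiltonianVF η (mlieBracket 𝓘(ℝ, E) X Y) := by
  refine ⟨hX.1.mlieBracket hY.1, fun Z hZ hZk x => ?_⟩
  have h := jacobi_mlieBracket hX.1 hY.1 hZ x
  rw [← sub_eq_iff_eq_add] at h
  rw [← h]
  exact (ker₁ η x).sub_mem
    (hX.2 _ (hY.1.mlieBracket hZ) (hY.2 Z hZ hZk) x)
    (hY.2 _ (hX.1.mlieBracket hZ) (hX.2 Z hZ hZk) x)

theorem mlieBracket_neg_left (hX : SmoothVF X) (Y : VField E M) (x : M) :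
    VectorField.mlieBracket 𝓘(ℝ, E) (-X) Y x = -VectorField.mlieBracket 𝓘(ℝ, E) X Y x := by
  have : CompleteSpace E := FiniteDimensional.complete ℝ E
  have := isManifold_one (E := E) (M := M)
  have h := mlieBracket_const_smul_left (I := 𝓘(ℝ, E)) (c := (-1 : ℝ)) (W := Y)
    ((hX x).mdifferentiableAt (by simp))
  rwa [neg_one_smul, neg_one_smul] at h

theorem mlieBracket_neg_right (hX : SmoothVF X) (Y : VField E M) (x : M) :
    VectorField.mlieBracket 𝓘(ℝ, E) Y (-X) x = -VectorField.mlieBracket 𝓘(ℝ, E) Y X x := by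
  rw [mlieBracket_swap_apply, mlieBracket_neg_left hX, mlieBracket_swap_apply (V := X), neg_neg]

theorem IsEtaHamiltonianVF.neg (hX : IsEtaHamiltonianVF η X) : IsEtaHamiltonianVF η (-X) :=
  ⟨hX.1.neg, fun Z hZ hZk x => by
    rw [mlieBracket_neg_left hX.1]
    exact (ker₁ η x).neg_mem (hX.2 Z hZ hZk x)⟩

variable [T2Space M]

/-- `ι_X dη = df` for the Hamiltonian vector field of a Reeb-invariant function. -/
theorem IsEtaHamiltonianPair.extD_apply (hη : IsKContactForm η) (h : IsEtaHamiltonianPair η X f)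
    (hf : ReebInvariant η f) (x : M) (w : TangentSpace 𝓘(ℝ, E) x) :
    extD η x ![X x, w] = mvfderiv 𝓘(ℝ, E) f x w := by
  have : CompleteSpace E := FiniteDimensional.complete ℝ E
  suffices hl : evalTwo (extD η) x (X x) = (mvfderiv 𝓘(ℝ, E) f x : _ →ₗ[ℝ] (Fin k → ℝ)) from
    congrArg (fun L : TangentSpace 𝓘(ℝ, E) x →ₗ[ℝ] (Fin k → ℝ) => L w) hl
  -- On `ker η` the invariant formula reduces to `-Y η(X) = Y f`; on Reeb vectors one side vanishes
  -- by `ι_R dη = 0`, the other by Reeb invariance.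
  refine eq_of_ker_of_reeb hη (fun v hv => ?_) (fun α => ?_)
  · obtain ⟨Y, hYs, hYk, rfl⟩ := exists_smoothVF_mem_ker hη hv
    have h1 := extD_apply_vectorField hη.smooth h.1.1 hYs x
    have h2 : (fun z => η z ![Y z]) = fun _ => 0 := funext hYk
    have h3 : η x ![VectorField.mlieBracket 𝓘(ℝ, E) X Y x] = 0 := h.1.2 Y hYs hYk x
    have h4 := h.eq_neg
    rw [h2, h3, mvfderiv_const] at h1
    rw [evalTwo_apply, h1, h4, mvfderiv_neg]
    simp
  · rw [evalTwo_apply, twoForm_swap, (isReebVector_reeb hη α x).2, neg_zero]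
    exact (hf α x).symm

/-- `f` fixes `η(X)`, and `df` fixes `ι_X dη`; together these determine `X`. -/
theorem IsEtaHamiltonianPair.unique (hη : IsKContactForm η) (hX : IsEtaHamiltonianPair η X f)
    (hY : IsEtaHamiltonianPair η Y f) (hf : ReebInvariant η f) : X = Y := by
  funext x
  refine hη.eq_of_eval (neg_injective ((hX.2 x).symm.trans (hY.2 x))) fun u => ?_
  rw [hX.extD_apply hη hf, hY.extD_apply hη hf]

/-- `η([X_f, X_g]) = dη(X_f, X_g)` for Reeb-invariant functions. -/
theorem IsEtaHamiltonianPair.form_mlieBracket (hη : IsKContactForm η)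
    (hX : IsEtaHamiltonianPair η X f) (hY : IsEtaHamiltonianPair η Y g)
    (hf : ReebInvariant η f) (hg : ReebInvariant η g) (x : M) :
    η x ![VectorField.mlieBracket 𝓘(ℝ, E) X Y x] = extD η x ![X x, Y x] := by
  have : CompleteSpace E := FiniteDimensional.complete ℝ E
  have h := extD_apply_vectorField hη.smooth hX.1.1 hY.1.1 x
  have hd : ∀ {Z : VField E M} {u : M → (Fin k → ℝ)}, IsEtaHamiltonianPair η Z u →
      ∀ v, mvfderiv 𝓘(ℝ, E) (fun z => η z ![Z z]) x v = - mvfderiv 𝓘(ℝ, E) u x v := by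
    intro Z u hZ v
    rw [hZ.eq_neg, mvfderiv_neg]
    simp
  -- Each of the two derivative terms equals `D = dη(X, Y)`, so the formula reads `D = D + D - η([X,
  -- Y])`.
  rw [hd hX, hd hY, ← hX.extD_apply hη hf, ← hY.extD_apply hη hg, twoForm_swap _ x (Y x)] at h
  rw [neg_neg, sub_neg_eq_add, eq_sub_iff_add_eq] at h
  exact add_left_cancel h

/-- `X_{{f, g}} = -[X_f, X_g]`. -/
theorem etaHamVF_etaBracket (hη : IsKContactForm η) (hf : IsEtaHamiltonianKFun η f)
    (hg : IsEtaHamiltonianKFun η g) (hfg : ReebInvariant η (etaBracket η f g)) :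
    etaHamVF η (etaBracket η f g) =
      -VectorField.mlieBracket 𝓘(ℝ, E) (etaHamVF η f) (etaHamVF η g) := by
  have h : IsEtaHamiltonianPair η
      (-VectorField.mlieBracket 𝓘(ℝ, E) (etaHamVF η f) (etaHamVF η g)) (etaBracket η f g) := by
    refine ⟨((isEtaHamiltonianPair_etaHamVF hf).1.mlieBracket
      (isEtaHamiltonianPair_etaHamVF hg).1).neg, fun x => ?_⟩
    change _ = -evalOne η x (-_)
    rw [map_neg, neg_neg]
    rfl
  exact (isEtaHamiltonianPair_etaHamVF ⟨_, h⟩).unique hη h hfg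

end Hamiltonian

/-! ### Transport of Lie algebras along linear maps. -/

section LieAlgebraMap

variable {A B : Type*} [AddCommGroup A] [Module ℝ A] [AddCommGroup B] [Module ℝ B]

/-- The image of a Lie algebra under a linear map compatible with the operations. -/
theorem IsLieAlgebra.map {V : Submodule ℝ A} {br : A → A → A} (h : IsLieAlgebra V br)
    (L : A →ₗ[ℝ] B) {br' : B → B → B} (hL : ∀ a ∈ V, ∀ b ∈ V, br' (L a) (L b) = L (br a b)) :
    IsLieAlgebra (V.map L) br' where
  closed := by
    rintro _ ⟨a, ha, rfl⟩ _ ⟨b, hb, rfl⟩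
    exact ⟨br a b, h.closed a ha b hb, (hL a ha b hb).symm⟩
  add_left := by
    rintro _ ⟨a, ha, rfl⟩ _ ⟨b, hb, rfl⟩ _ ⟨c, hc, rfl⟩
    rw [← map_add, hL _ (V.add_mem ha hb) c hc, h.add_left a ha b hb c hc, map_add,
      hL a ha c hc, hL b hb c hc]
  add_right := by
    rintro _ ⟨a, ha, rfl⟩ _ ⟨b, hb, rfl⟩ _ ⟨c, hc, rfl⟩
    rw [← map_add, hL a ha _ (V.add_mem hb hc), h.add_right a ha b hb c hc, map_add,
      hL a ha b hb, hL a ha c hc]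
  smul_right := by
    rintro r _ ⟨a, ha, rfl⟩ _ ⟨b, hb, rfl⟩
    rw [← map_smul, hL a ha _ (V.smul_mem r hb), h.smul_right r a ha b hb, map_smul,
      hL a ha b hb]
  self := by
    rintro _ ⟨a, ha, rfl⟩
    rw [hL a ha a ha, h.self a ha, map_zero]
  jacobi := by
    rintro _ ⟨a, ha, rfl⟩ _ ⟨b, hb, rfl⟩ _ ⟨c, hc, rfl⟩
    have hab := h.closed a ha b hb
    have hac := h.closed a ha c hc
    have hbc := h.closed b hb c hc
    rw [hL b hb c hc, hL a ha _ hbc, hL a ha b hb, hL _ hab c hc, hL a ha c hc, hL b hb _ hac,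
      h.jacobi a ha b hb c hc, map_add]

end LieAlgebraMap

/-! ### Constants of motion, the Lie algebra of `k`-functions, and pairing with `θ`. -/

section Main

variable {E : Type*} [NormedAddCommGroup E] [NormedSpace ℝ E]
variable {M : Type*} [TopologicalSpace M] [ChartedSpace E M]

theorem isConstantOfMotion_of_mfderiv_eq_zero {X : ℝ → VField E M} {C : M → ℝ}
    (hC : ContMDiff 𝓘(ℝ, E) 𝓘(ℝ, ℝ) ∞ C)
    (h : ∀ t x, mfderiv 𝓘(ℝ, E) 𝓘(ℝ, ℝ) C x (X t x) = 0) : IsConstantOfMotion X C := by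
  intro J γ hJ hγ s hs t ht
  have hd : ∀ u ∈ J, HasDerivWithinAt (C ∘ γ) 0 J u := by
    intro u hu
    have h1 := ((hC (γ u)).mdifferentiableAt (by simp)).hasMFDerivAt.comp_hasMFDerivWithinAt u
      (hγ u hu)
    obtain ⟨D, hD, hD1⟩ : ∃ D : ℝ →L[ℝ] ℝ, HasFDerivWithinAt (C ∘ γ) D J u ∧ D 1 = 0 := by
      refine ⟨_, h1.hasFDerivWithinAt, ?_⟩
      refine (congrArg (mfderiv 𝓘(ℝ, E) 𝓘(ℝ, ℝ) C (γ u)) ?_).trans (h u (γ u))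
      exact one_smul ℝ (X u (γ u))
    have h3 := hD.hasDerivWithinAt
    rwa [hD1] at h3
  -- Mean value inequality with bound `0`; working with derivatives within `J` allows any interval,
  -- including its endpoints.
  have := Convex.norm_image_sub_le_of_norm_hasDerivWithin_le (C := 0) hd (by simp)
    hJ.convex hs ht
  rw [zero_mul, norm_le_zero_iff, sub_eq_zero] at this
  exact this.symm

variable [IsManifold 𝓘(ℝ, E) ∞ M]
variable {k : ℕ} {η : DForm E M (Fin k → ℝ) 1} {X Y : VField E M} {f g : M → (Fin k → ℝ)}

/-- The form is exact, with primitive `⟨η, θ⟩`. -/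
theorem isPresymplectic_pairForm_extD (hη : SmoothForm η) (θ : (Fin k → ℝ) →L[ℝ] ℝ) :
    IsPresymplectic (pairForm (extD η) θ) := by
  rw [← extD_pairForm hη]
  exact ⟨(hη.pairForm θ).extD, extD_extD (hη.pairForm θ)⟩

variable [FiniteDimensional ℝ E] [T2Space M]

theorem IsEtaHamiltonianPair.isHamiltonianVector (hη : IsKContactForm η)
    (h : IsEtaHamiltonianPair η X f) (hf : ReebInvariant η f) (θ : (Fin k → ℝ) →L[ℝ] ℝ) (x : M) :
    IsHamiltonianVector (pairForm (extD η) θ) (fun z => θ (f z)) x (X x) := by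
  intro w
  have h1 : mfderiv 𝓘(ℝ, E) 𝓘(ℝ, ℝ) (θ ∘ f) x = _ := mfderiv_comp x
    θ.mdifferentiableAt ((h.contMDiff hη.smooth x).mdifferentiableAt (by simp))
  rw [ContinuousLinearMap.mfderiv_eq] at h1
  refine (congrArg θ (h.extD_apply hη hf x w)).trans ?_
  exact (congrArg (fun L : E →L[ℝ] ℝ => L w) h1).symm

variable {W : Submodule ℝ (M → (Fin k → ℝ))}

theorem etaBracket_apply (hη : IsKContactForm η) (hf : IsEtaHamiltonianKFun η f)
    (hg : IsEtaHamiltonianKFun η g) (hf' : ReebInvariant η f) (hg' : ReebInvariant η g) (x : M) :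
    etaBracket η f g x = extD η x ![etaHamVF η f x, etaHamVF η g x] :=
  (isEtaHamiltonianPair_etaHamVF hf).form_mlieBracket hη (isEtaHamiltonianPair_etaHamVF hg)
    hf' hg' x

theorem etaBracket_swap (hη : IsKContactForm η) (hf : IsEtaHamiltonianKFun η f)
    (hg : IsEtaHamiltonianKFun η g) (hf' : ReebInvariant η f) (hg' : ReebInvariant η g) :
    etaBracket η f g = -etaBracket η g f := by
  funext x
  rw [Pi.neg_apply, etaBracket_apply hη hf hg hf' hg', etaBracket_apply hη hg hf hg' hf',
    twoForm_swap]

/-- In this form linearity in `f` is that of the differential, so nothing need be known about how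
`etaHamVF` treats sums and multiples. -/
theorem etaBracket_eq_mvfderiv (hη : IsKContactForm η) (hf : IsEtaHamiltonianKFun η f)
    (hg : IsEtaHamiltonianKFun η g) (hf' : ReebInvariant η f) (hg' : ReebInvariant η g) (x : M) :
    etaBracket η f g x = mvfderiv 𝓘(ℝ, E) f x (etaHamVF η g x) := by
  rw [etaBracket_apply hη hf hg hf' hg', (isEtaHamiltonianPair_etaHamVF hf).extD_apply hη hf']

/-- Reeb-invariant Hamiltonian functions closed under the bracket form a Lie algebra. -/
theorem isLieAlgebra_etaBracket (hη : IsKContactForm η) (hH : ∀ f ∈ W, IsEtaHamiltonianKFun η f)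
    (hcl : ∀ f ∈ W, ∀ g ∈ W, etaBracket η f g ∈ W) (hR : ∀ f ∈ W, ReebInvariant η f) :
    IsLieAlgebra W (etaBracket η) := by
  have hdiff : ∀ f ∈ W, ∀ x, MDifferentiableAt 𝓘(ℝ, E) 𝓘(ℝ, Fin k → ℝ) f x := fun f hf x =>
    ((isEtaHamiltonianPair_etaHamVF (hH f hf)).contMDiff hη.smooth x).mdifferentiableAt (by simp)
  have hsw : ∀ f ∈ W, ∀ g ∈ W, etaBracket η f g = -etaBracket η g f := fun f hf g hg =>
    etaBracket_swap hη (hH f hf) (hH g hg) (hR f hf) (hR g hg)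
  have hmv : ∀ f ∈ W, ∀ g ∈ W, ∀ x,
      etaBracket η f g x = mvfderiv 𝓘(ℝ, E) f x (etaHamVF η g x) := fun f hf g hg =>
    etaBracket_eq_mvfderiv hη (hH f hf) (hH g hg) (hR f hf) (hR g hg)
  have hadd : ∀ a ∈ W, ∀ b ∈ W, ∀ c ∈ W,
      etaBracket η (a + b) c = etaBracket η a c + etaBracket η b c := by
    intro a ha b hb c hc
    funext x
    rw [Pi.add_apply, hmv _ (W.add_mem ha hb) c hc, hmv a ha c hc, hmv b hb c hc,
      mvfderiv_add (hdiff a ha x) (hdiff b hb x), add_apply]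
  have hbr : ∀ a ∈ W, ∀ b ∈ W, etaHamVF η (etaBracket η a b) =
      -mlieBracket 𝓘(ℝ, E) (etaHamVF η a) (etaHamVF η b) := fun a ha b hb =>
    etaHamVF_etaBracket hη (hH a ha) (hH b hb) (hR _ (hcl a ha b hb))
  have hs : ∀ a ∈ W, SmoothVF (etaHamVF η a) := fun a ha =>
    (isEtaHamiltonianPair_etaHamVF (hH a ha)).1.1
  refine ⟨hcl, hadd, ?_, ?_, ?_, ?_⟩
  · intro a ha b hb c hc
    rw [hsw a ha _ (W.add_mem hb hc), hadd b hb c hc a ha, neg_add, ← hsw a ha b hb,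
      ← hsw a ha c hc]
  · intro r a ha b hb
    rw [hsw a ha _ (W.smul_mem r hb), hsw a ha b hb, smul_neg]
    congr 1
    funext x
    -- The Leibniz rule is applied with `r` as a constant function, whose derivative term drops out.
    have h := mvfderiv_smul (I := 𝓘(ℝ, E)) (x := x) (a := fun _ => r) mdifferentiableAt_const
      (hdiff b hb x)
    rw [mvfderiv_const] at h
    have h' := congrArg (fun L => L (etaHamVF η a x)) h
    rw [Pi.smul_apply, hmv _ (W.smul_mem r hb) a ha, hmv b hb a ha]
    have hr : r • b = (fun _ : M => r) • b := rfl
    rw [hr]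
    simpa using h'
  · intro a ha
    exact self_eq_neg.1 (hsw a ha a ha)
  · intro a ha b hb c hc
    funext x
    -- Replacing each inner `X_{{·,·}}` by minus a Lie bracket puts exactly one sign on each of the
    -- three terms, so `η` of the vector field identity is what is needed.
    have hj := congrArg (evalOne η x) (jacobi_mlieBracket (hs a ha) (hs b hb) (hs c hc) x)
    rw [map_add] at hj
    change evalOne η x _ = evalOne η x _ + evalOne η x _
    rw [hbr b hb c hc, hbr a ha b hb, hbr a ha c hc,
      mlieBracket_neg_right ((hs b hb).mlieBracket (hs c hc)),
      mlieBracket_neg_left ((hs a ha).mlieBracket (hs b hb)),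
      mlieBracket_neg_right ((hs a ha).mlieBracket (hs c hc)), map_neg, map_neg, map_neg, hj,
      neg_add]

/-- The bracket of `ω` does not depend on the chosen Hamiltonian vectors, so it may be computed with
`X_f` and `X_g`, where it is `θ` of `dη(X_f, X_g)`. -/
theorem poissonBracket_pair (hη : IsKContactForm η) (θ : (Fin k → ℝ) →L[ℝ] ℝ)
    (hf : IsEtaHamiltonianKFun η f) (hg : IsEtaHamiltonianKFun η g) (hf' : ReebInvariant η f)
    (hg' : ReebInvariant η g) :
    poissonBracket (pairForm (extD η) θ) (fun x => θ (f x)) (fun x => θ (g x)) =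
      fun x => θ (etaBracket η f g x) := by
  funext x
  rw [poissonBracket_eq _
    ((isEtaHamiltonianPair_etaHamVF hf).isHamiltonianVector hη hf' θ x)
    ((isEtaHamiltonianPair_etaHamVF hg).isHamiltonianVector hη hg' θ x),
    etaBracket_apply hη hf hg hf' hg']
  rfl

theorem isHamiltonianFunction_pair (hη : IsKContactForm η) (θ : (Fin k → ℝ) →L[ℝ] ℝ)
    (hf : IsEtaHamiltonianKFun η f) (hf' : ReebInvariant η f) :
    IsHamiltonianFunction (pairForm (extD η) θ) (fun x => θ (f x)) := by
  have h := isEtaHamiltonianPair_etaHamVF hf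
  exact ⟨θ.contDiff.contMDiff.comp (h.contMDiff hη.smooth), etaHamVF η f, h.1.1,
    h.isHamiltonianVector hη hf' θ⟩

/-- With `ι_v ω = dC` at `x`, the bracket there is `ω(v, X) = dC(X)`. Only a vector at `x` is
required, so admissibility of `C` suffices. -/
theorem mfderiv_apply_eq_zero_of_poissonBracket (hη : IsKContactForm η) (θ : (Fin k → ℝ) →L[ℝ] ℝ)
    (h : IsEtaHamiltonianPair η X f) (hf : ReebInvariant η f) {C : M → ℝ}
    (hC : IsAdmissible (pairForm (extD η) θ) C)
    (hCf : poissonBracket (pairForm (extD η) θ) C (fun x => θ (f x)) = 0) (x : M) :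
    mfderiv 𝓘(ℝ, E) 𝓘(ℝ, ℝ) C x (X x) = 0 := by
  obtain ⟨v, hv⟩ := hC.2 x
  have h0 := congrFun hCf x
  rw [poissonBracket_eq _ hv (h.isHamiltonianVector hη hf θ x), hv] at h0
  exact h0

end Main

end KContact

end

open KContact in
theorem mainTheorem4
    {E : Type*} [NormedAddCommGroup E] [NormedSpace ℝ E] [FiniteDimensional ℝ E]
    {M : Type*} [TopologicalSpace M] [T2Space M] [ChartedSpace E M] [IsManifold 𝓘(ℝ, E) ∞ M]
    {k : ℕ} (η : DForm E M (Fin k → ℝ) 1) (hη : IsKContactForm η)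
    (θ : (Fin k → ℝ) →L[ℝ] ℝ)
    (Ω : DForm E M ℝ 2) (hΩ : Ω = pairForm (extD η) θ) :
    IsPresymplectic Ω ∧
    ∀ (r : ℕ) (h : Fin r → M → (Fin k → ℝ))
      (W : Submodule ℝ (M → (Fin k → ℝ))) (Wθ : Submodule ℝ (M → ℝ)),
      W = Submodule.span ℝ (Set.range h) →
      Wθ = Submodule.span ℝ (Set.range fun i x => θ (h i x)) →
      (∀ f ∈ W, IsEtaHamiltonianKFun η f) →
      (∀ f ∈ W, ∀ g ∈ W, etaBracket η f g ∈ W) →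
      (∀ f ∈ W, ReebInvariant η f) →
      (∀ g ∈ Wθ, IsHamiltonianFunction Ω g) ∧
      (∃ (hW : IsLieAlgebra W (etaBracket η)) (hWθ : IsLieAlgebra Wθ (poissonBracket Ω)),
        letI := hW.lieRing
        letI := hW.lieAlgebra
        letI := hWθ.lieRing
        letI := hWθ.lieAlgebra
        ∃ φ : W →ₗ⁅ℝ⁆ Wθ, (∀ (f : W) (x : M), (φ f : M → ℝ) x = θ ((f : M → (Fin k → ℝ)) x)) ∧
          Function.Surjective φ) ∧
      (∀ C : M → ℝ, IsAdmissible Ω C → (∀ g ∈ Wθ, poissonBracket Ω C g = 0) →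
        ∀ X : ℝ → VField E M, AdmitsLieHamiltonAlgebra η W X →
          IsConstantOfMotion X C ∧
            ∀ t x, mfderiv 𝓘(ℝ, E) 𝓘(ℝ, ℝ) C x (X t x) = 0) := by
  subst hΩ
  refine ⟨isPresymplectic_pairForm_extD hη.smooth θ, ?_⟩
  intro r h W Wθ hW hWθ hH hcl hR
  -- Linear maps commute with spans, so every element of `Wθ` is `θ ∘ f` with `f ∈ W`; each claim
  -- about `Wθ` then reduces to one about `W`, and surjectivity is immediate.
  have hmap : Wθ = W.map (θ.toLinearMap.compLeft M) := by
    rw [hWθ, hW, Submodule.map_span, ← Set.range_comp]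
    rfl
  subst hmap
  have hLie := isLieAlgebra_etaBracket hη hH hcl hR
  have hbr : ∀ f ∈ W, ∀ g ∈ W, poissonBracket (pairForm (extD η) θ)
      (θ.toLinearMap.compLeft M f) (θ.toLinearMap.compLeft M g) =
        θ.toLinearMap.compLeft M (etaBracket η f g) := fun f hf g hg =>
    poissonBracket_pair hη θ (hH f hf) (hH g hg) (hR f hf) (hR g hg)
  refine ⟨?_, ⟨hLie, hLie.map _ hbr, ?_⟩, ?_⟩
  · rintro _ ⟨f, hf, rfl⟩
    exact isHamiltonianFunction_pair hη θ (hH f hf) (hR f hf)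
  · let _ := hLie.lieRing
    let _ := hLie.lieAlgebra
    let _ := (hLie.map _ hbr).lieRing
    let _ := (hLie.map _ hbr).lieAlgebra
    refine ⟨{ (θ.toLinearMap.compLeft M).submoduleMap W with
      map_lie' := fun {f g} => Subtype.ext (hbr f f.2 g g.2).symm }, fun f x => rfl, ?_⟩
    exact (θ.toLinearMap.compLeft M).submoduleMap_surjective W
  · intro C hC hCW X hX
    have hzero : ∀ t x, mfderiv 𝓘(ℝ, E) 𝓘(ℝ, ℝ) C x (X t x) = 0 := by
      intro t x
      obtain ⟨f, hf, hXf⟩ := hX t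
      exact mfderiv_apply_eq_zero_of_poissonBracket hη θ hXf (hR f hf) hC (hCW _ ⟨f, hf, rfl⟩) x
    exact ⟨isConstantOfMotion_of_mfderiv_eq_zero hC.1 hzero, hzero⟩
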